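/- All graphs are finite and simple, and $|G|$ denotes the number of vertices of a graph $G$. For two non-empty families of graphs $\mathcal G,\mathcal H$ let $r(\mathcal G,\mathcal H)$ be the smallest $N$ such that every colouring of the edges of the complete graph $K_N$ with two colours contains a (not necessarily induced) copy of some member of $\mathcal G$ all of whose edges have the first colour, or a copy of some member of $\mathcal H$ all of whose edges have the second colour; a single graph stands for the family consisting of it alone. Let $nH$ be the disjoint union of $n$ copies of $H$, and let $\mathcal D(G)$ be the family of all graphs $G-I$, where $I$ is an inclusion-maximal independent set of $G$. Theorem. Let $G$ be a graph with at least one edge, let $H$ be a connected graph (with at least one vertex), and let $k=\max\{|G|,|H|\}$. Then for every integer $n\ge 2^{32}k^{10}\,r(G,H)^2$, $$ r(G,nH)=n|H|+r(\mathcal D(G),H)-1 . $$ -/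

import Mathlib

open SimpleGraph

/-- `RamseyArrows 𝒢 ℋ N`: every 2-colouring of the edges of `K_N` (the graph `R` of the edges of the
first colour, and its complement, the graph of the edges of the second colour) contains a copy of
some member of `𝒢` in the first colour or a copy of some member of `ℋ` in the second. Copies are not
required to be induced. The families of graphs are indexed families. -/
def RamseyArrows {ι κ : Type*} {V : ι → Type*} {W : κ → Type*}
    (𝒢 : ∀ i, SimpleGraph (V i)) (ℋ : ∀ j, SimpleGraph (W j)) (N : ℕ) : Prop :=
  ∀ R : SimpleGraph (Fin N), (∃ i, (𝒢 i).IsContained R) ∨ (∃ j, (ℋ j).IsContained Rᶜ)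

/-- The Ramsey number `r(𝒢, ℋ)` of two families of graphs: the smallest `N` such that every
2-colouring of the edges of `K_N` contains a member of `𝒢` in the first colour or a member of `ℋ` in
the second. Such an `N` exists for non-empty families of finite graphs, see
`exists_ramseyArrows`. -/
noncomputable def familyRamsey {ι κ : Type*} {V : ι → Type*} {W : κ → Type*}
    (𝒢 : ∀ i, SimpleGraph (V i)) (ℋ : ∀ j, SimpleGraph (W j)) : ℕ :=
  sInf {N : ℕ | RamseyArrows 𝒢 ℋ N}

/-- A one-member family of graphs. -/
def singleFamily {V : Type*} (G : SimpleGraph V) : Unit → SimpleGraph V :=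
  fun _ => G

/-- The Ramsey number `r(G, H)` of two graphs. -/
noncomputable def graphRamsey {V W : Type*} (G : SimpleGraph V) (H : SimpleGraph W) : ℕ :=
  familyRamsey (singleFamily G) (singleFamily H)

/-- `nH`, the disjoint union of `n` copies of `H`. -/
def disjointCopies {W : Type*} (n : ℕ) (H : SimpleGraph W) : SimpleGraph (Fin n × W) where
  Adj x y := x.1 = y.1 ∧ H.Adj x.2 y.2
  symm := ⟨fun _ _ h => ⟨h.1.symm, h.2.symm⟩⟩
  loopless := ⟨fun _ h => H.loopless.irrefl _ h.2⟩

/-- The family `𝒟(G)` of the graphs `G - I`, where `I` runs over the maximal (with respect to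
inclusion) independent sets of `G`. -/
def deletionFamily {V : Type*} (G : SimpleGraph V) (I : {I : Set V // Maximal G.IsIndepSet I}) :
    SimpleGraph ((I : Set V)ᶜ : Set V) :=
  G.induce ((I : Set V)ᶜ)

/-- Ramsey's theorem for cliques. -/
theorem exists_clique_or_compl_clique (a b : ℕ) :
    ∃ N : ℕ, ∀ (α : Type) (R : SimpleGraph α) (s : Finset α), N ≤ s.card →
      (∃ t ⊆ s, t.card = a ∧ R.IsClique (t : Set α)) ∨
      (∃ t ⊆ s, t.card = b ∧ Rᶜ.IsClique (t : Set α)) := by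
  classical
  induction a generalizing b with
  | zero => exact ⟨0, fun α R s _ => Or.inl ⟨∅, by simp, by simp, by simp⟩⟩
  | succ a iha =>
    induction b with
    | zero => exact ⟨0, fun α R s _ => Or.inr ⟨∅, by simp, by simp, by simp⟩⟩
    | succ b ihb =>
      obtain ⟨N₁, h₁⟩ := iha (b + 1)
      obtain ⟨N₂, h₂⟩ := ihb
      refine ⟨N₁ + N₂ + 1, fun α R s hs => ?_⟩
      obtain ⟨v, hv⟩ : s.Nonempty := Finset.card_pos.mp (by omega)
      have hcard := Finset.card_filter_add_card_filter_not (s := s.erase v) (fun w => R.Adj v w)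
      rw [Finset.card_erase_of_mem hv] at hcard
      by_cases hN : N₁ ≤ ((s.erase v).filter (fun w => R.Adj v w)).card
      · rcases h₁ α R _ hN with ⟨t, hts, htc, ht⟩ | ⟨t, hts, htc, ht⟩
        · have hvt : v ∉ t := fun h => by simpa using hts h
          refine Or.inl ⟨insert v t, ?_, by simp [hvt, htc], ?_⟩
          · intro x hx
            rcases Finset.mem_insert.mp hx with rfl | hx
            · exact hv
            · exact Finset.mem_of_mem_erase (Finset.mem_filter.mp (hts hx)).1
          · rw [Finset.coe_insert, isClique_insert]
            exact ⟨ht, fun x hx _ => (Finset.mem_filter.mp (hts hx)).2⟩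
        · exact Or.inr ⟨t, fun x hx => Finset.mem_of_mem_erase
            (Finset.mem_filter.mp (hts hx)).1, htc, ht⟩
      · rcases h₂ α R ((s.erase v).filter (fun w => ¬ R.Adj v w)) (by omega) with
          ⟨t, hts, htc, ht⟩ | ⟨t, hts, htc, ht⟩
        · exact Or.inl ⟨t, fun x hx => Finset.mem_of_mem_erase
            (Finset.mem_filter.mp (hts hx)).1, htc, ht⟩
        · have hvt : v ∉ t := fun h => by simpa using hts h
          refine Or.inr ⟨insert v t, ?_, by simp [hvt, htc], ?_⟩
          · intro x hx
            rcases Finset.mem_insert.mp hx with rfl | hx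
            · exact hv
            · exact Finset.mem_of_mem_erase (Finset.mem_filter.mp (hts hx)).1
          · rw [Finset.coe_insert, isClique_insert]
            refine ⟨ht, fun x hx hne => ?_⟩
            rw [compl_adj]
            exact ⟨hne, (Finset.mem_filter.mp (hts hx)).2⟩

/-- A graph on `a` vertices is contained in every graph that has a clique of order `a`. -/
theorem isContained_of_isClique {V α : Type*} [Fintype V] (G : SimpleGraph V) (R : SimpleGraph α)
    (t : Finset α) (htc : t.card = Fintype.card V) (ht : R.IsClique (t : Set α)) :
    G.IsContained R := by
  have e : V ≃ t := Fintype.equivOfCardEq (by simp [htc])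
  refine ⟨⟨⟨fun v => (e v : α), fun {x y} h => ?_⟩, ?_⟩⟩
  · exact ht (e x).2 (e y).2 (fun he => h.ne (e.injective (Subtype.ext he)))
  · intro x y h
    exact e.injective (Subtype.ext h)

/-- The Ramsey number of two families, each with a finite member, is a minimum over a non-empty
set. -/
theorem exists_ramseyArrows {ι κ : Type*} {V : ι → Type*} {W : κ → Type*}
    (𝒢 : ∀ i, SimpleGraph (V i)) (ℋ : ∀ j, SimpleGraph (W j))
    (i : ι) (j : κ) [Finite (V i)] [Finite (W j)] : ∃ N : ℕ, RamseyArrows 𝒢 ℋ N := by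
  have := Fintype.ofFinite (V i)
  have := Fintype.ofFinite (W j)
  obtain ⟨N, hN⟩ := exists_clique_or_compl_clique (Fintype.card (V i)) (Fintype.card (W j))
  refine ⟨N, fun R => ?_⟩
  rcases hN (Fin N) R Finset.univ (by simp) with ⟨t, -, htc, ht⟩ | ⟨t, -, htc, ht⟩
  · exact Or.inl ⟨i, isContained_of_isClique _ _ t htc ht⟩
  · exact Or.inr ⟨j, isContained_of_isClique _ _ t htc ht⟩

/-! Write d for r(𝒟(G), H), r for r(G, H) and h for |H|.

Lower bound: join a blue clique of order nh - 1 in red to a colouring of order d - 1 with no red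
member of 𝒟(G) and no blue H. A red G meets the clique in an independent set, so the rest of it
contains a red G - I with I maximal independent. A blue copy of the connected graph H lies on one
side, hence in the clique, which is too small for n copies (`not_ramseyArrows_disjointCopies`).

Upper bound: without a red G, every r vertices contain a blue H, which serves as a tile. It suffices
to tile all but at most (d - 1) + (h - 1) vertices, since the number of tiled vertices is a multiple
of h (`exists_tiled_of_not_isContained`). The tool is absorption: a set Y and a disjoint set U such
that U ∪ T can be tiled for every T ⊆ Y of order r (`IsCluster.exists_flexible`). Vertices with few
blue neighbours in Y are tiled down to fewer than d, because a red G - I among them would extend to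
a red G with I placed in Y (`exists_isTile_of_few_neighbours`). The others are tiled down to fewer
than r, and these are covered by tiles using Y (`exists_tiled_cover`). The rest of Y is tiled down
to between r and r + h - 1 vertices, of which U absorbs r.

The absorber is made of gadgets, sets that any one vertex of O completes to a tiled set. A tile in
the common blue neighbourhood of O, less one vertex, is a gadget for O. Gadgets for pairs are
chained along short paths of linked vertices, and triples with many common neighbours provide the
branching needed for larger O. A cluster (`exists_isCluster`) supplies both even after the deletion
of the vertices already used. -/

/-! ### Ramsey numbers of families -/

/-- A copy of `H` in `B` all of whose vertices lie in `s`. -/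
def EmbedsIn {α W : Type*} (H : SimpleGraph W) (B : SimpleGraph α) (s : Finset α) : Prop :=
  ∃ f : W → α, Function.Injective f ∧ (∀ x y, H.Adj x y → B.Adj (f x) (f y)) ∧ ∀ x, f x ∈ s

theorem EmbedsIn.isContained {α W : Type*} {H : SimpleGraph W} {B : SimpleGraph α} {s : Finset α}
    (h : EmbedsIn H B s) : H.IsContained B := by
  obtain ⟨f, hf, hadj, -⟩ := h
  exact ⟨⟨⟨f, fun {x y} h => hadj x y h⟩, hf⟩⟩

/-- Pulling a colouring back along an injection of `Fin N` makes the Ramsey property usable inside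
any vertex set of order at least `N`. -/
theorem RamseyArrows.embedsIn {ι κ α : Type*} {V : ι → Type*} {W : κ → Type*}
    {𝒢 : ∀ i, SimpleGraph (V i)} {ℋ : ∀ j, SimpleGraph (W j)} {N : ℕ}
    (h : RamseyArrows 𝒢 ℋ N) (R : SimpleGraph α) (s : Finset α) (hs : N ≤ s.card) :
    (∃ i, EmbedsIn (𝒢 i) R s) ∨ (∃ j, EmbedsIn (ℋ j) Rᶜ s) := by
  let e : Fin N ↪ α := (Fin.castLEEmb hs).trans
    (s.equivFin.symm.toEmbedding.trans (Function.Embedding.subtype _))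
  have he : ∀ x, e x ∈ s := fun x => (s.equivFin.symm (Fin.castLEEmb hs x)).2
  rcases h (R.comap e) with ⟨i, ⟨f⟩⟩ | ⟨j, ⟨f⟩⟩
  · exact Or.inl ⟨i, fun x => e (f x), fun x y hxy => f.injective (e.injective hxy),
      fun x y hxy => f.toHom.map_adj hxy, fun x => he _⟩
  · refine Or.inr ⟨j, fun x => e (f x), fun x y hxy => f.injective (e.injective hxy),
      fun x y hxy => ?_, fun x => he _⟩
    have := f.toHom.map_adj hxy
    rw [compl_adj] at this ⊢
    exact ⟨fun h => this.1 (e.injective h), this.2⟩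

theorem RamseyArrows.mono {ι κ : Type*} {V : ι → Type*} {W : κ → Type*}
    {𝒢 : ∀ i, SimpleGraph (V i)} {ℋ : ∀ j, SimpleGraph (W j)} {N M : ℕ}
    (h : RamseyArrows 𝒢 ℋ N) (hNM : N ≤ M) : RamseyArrows 𝒢 ℋ M := fun R => by
  rcases h.embedsIn R Finset.univ (by simpa using hNM) with ⟨i, hi⟩ | ⟨j, hj⟩
  · exact Or.inl ⟨i, hi.isContained⟩
  · exact Or.inr ⟨j, hj.isContained⟩

theorem ramseyArrows_familyRamsey {ι κ : Type*} {V : ι → Type*} {W : κ → Type*}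
    (𝒢 : ∀ i, SimpleGraph (V i)) (ℋ : ∀ j, SimpleGraph (W j))
    (i : ι) (j : κ) [Finite (V i)] [Finite (W j)] : RamseyArrows 𝒢 ℋ (familyRamsey 𝒢 ℋ) :=
  Nat.sInf_mem (s := {N | RamseyArrows 𝒢 ℋ N}) (exists_ramseyArrows 𝒢 ℋ i j)

theorem not_ramseyArrows_of_lt {ι κ : Type*} {V : ι → Type*} {W : κ → Type*}
    {𝒢 : ∀ i, SimpleGraph (V i)} {ℋ : ∀ j, SimpleGraph (W j)} {N : ℕ}
    (h : N < familyRamsey 𝒢 ℋ) : ¬ RamseyArrows 𝒢 ℋ N :=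
  Nat.notMem_of_lt_sInf (s := {N | RamseyArrows 𝒢 ℋ N}) h

theorem familyRamsey_pos {ι κ : Type*} {V : ι → Type*} {W : κ → Type*}
    (𝒢 : ∀ i, SimpleGraph (V i)) (ℋ : ∀ j, SimpleGraph (W j))
    (i : ι) (j : κ) [Finite (V i)] [Finite (W j)] [∀ i, Nonempty (V i)] [∀ j, Nonempty (W j)] :
    0 < familyRamsey 𝒢 ℋ := by
  by_contra h0
  have h := ramseyArrows_familyRamsey 𝒢 ℋ i j
  rw [Nat.eq_zero_of_not_pos h0] at h
  rcases h ⊥ with ⟨i, ⟨f⟩⟩ | ⟨j, ⟨f⟩⟩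
  · exact (f (Classical.arbitrary _)).elim0
  · exact (f (Classical.arbitrary _)).elim0

theorem exists_maximal_isIndepSet_superset {V : Type*} [Finite V] (G : SimpleGraph V) (I : Set V)
    (hI : G.IsIndepSet I) : ∃ J, I ⊆ J ∧ Maximal G.IsIndepSet J :=
  (Set.toFinite {J : Set V | G.IsIndepSet J}).exists_le_maximal hI

/-- An edge has an end outside every independent set. Hence 𝒟(G) has no null member, which makes
r(𝒟(G), H) positive and the subtraction of 1 genuine. -/
theorem nonempty_compl_of_isIndepSet {V : Type*} {G : SimpleGraph V} (hG : G ≠ ⊥) {I : Set V}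
    (hI : G.IsIndepSet I) : Nonempty (Iᶜ : Set V) := by
  obtain ⟨x, y, hxy⟩ := G.ne_bot_iff_exists_adj.mp hG
  by_contra hne
  have hall : ∀ v, v ∈ I := fun v => by
    by_contra hv
    exact hne ⟨⟨v, hv⟩⟩
  exact hI (hall x) (hall y) hxy.ne hxy

/-! ### The lower bound -/

/-- No edge crosses a disjoint sum. This is how the connectedness of H enters the lower bound. -/
theorem isLeft_eq_of_reachable {V A B : Type*} {G : SimpleGraph V} {S : SimpleGraph A}
    {T : SimpleGraph B} (f : V → A ⊕ B) (hf : ∀ x y, G.Adj x y → (S ⊕g T).Adj (f x) (f y))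
    {x y : V} (h : G.Reachable x y) : (f x).isLeft = (f y).isLeft := by
  obtain ⟨p⟩ := h
  induction p with
  | nil => rfl
  | cons hxy _ ih =>
    rw [← ih]
    have := hf _ _ hxy
    revert this
    rcases f _ with a | a <;> rcases f _ with b | b <;> simp

/-- The colouring consisting of a blue clique of order less than `n * |H|`, completely joined in red
to a colouring without a red member of `𝒟(G)` and without a blue `H`. -/
theorem not_ramseyArrows_disjointCopies {V W : Type*} [Finite V] [Fintype W] {G : SimpleGraph V}
    {H : SimpleGraph W} (hH : H.Connected) {n a d : ℕ} (ha : a < n * Fintype.card W)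
    (hd : ¬ RamseyArrows (deletionFamily G) (singleFamily H) d) :
    ¬ RamseyArrows (singleFamily G) (singleFamily (disjointCopies n H)) (a + d) := by
  intro h
  obtain ⟨R₀, hR₀⟩ := not_forall.mp hd
  rw [not_or, not_exists, not_exists] at hR₀
  obtain ⟨hred, hblue⟩ := hR₀
  rcases h.embedsIn ((⊤ : SimpleGraph (Fin a)) ⊕g R₀ᶜ)ᶜ Finset.univ (by simp) with
    ⟨_, f, hf, hadj, -⟩ | ⟨_, f, hf, hadj, -⟩
  -- The clique has no red edge, so the vertices of G placed in it are independent. Enlarging this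
  -- set to a maximal one only shrinks the part of G to be found in `R₀`.
  · obtain ⟨J, hIJ, hJ⟩ := exists_maximal_isIndepSet_superset G {v | (f v).isLeft} (by
      intro x hx y hy hne hxy
      have h1 := hadj x y hxy
      have h2 : f x ≠ f y := fun h => hne (hf h)
      revert h1 h2
      obtain ⟨x', hx'⟩ := Sum.isLeft_iff.mp hx
      obtain ⟨y', hy'⟩ := Sum.isLeft_iff.mp hy
      rw [hx', hy']
      simp)
    have hr : ∀ v : (Jᶜ : Set V), ∃ b, f v = Sum.inr b := fun v =>
      Sum.isRight_iff.mp (by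
        by_contra hv
        exact v.2 (hIJ (by simpa using hv)))
    choose g hg using hr
    refine hred ⟨J, hJ⟩ ⟨⟨⟨g, fun {x y} hxy => ?_⟩, fun x y hxy => ?_⟩⟩
    · have h1 := hadj x y hxy
      have h2 : g x ≠ g y := fun h => hxy.ne (Subtype.ext (hf (by rw [hg, hg, h])))
      rw [hg, hg] at h1
      simpa [h2] using h1
    · exact Subtype.ext (hf (by rw [hg, hg]; exact congrArg _ hxy))
  · rw [compl_compl] at hadj
    have hl : ∀ x, ∃ b, f x = Sum.inl b := by
      rintro ⟨i, w⟩
      by_contra hx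
      have hr : ∀ w' : W, ∃ b, f (i, w') = Sum.inr b := fun w' => by
        rw [← Sum.isRight_iff]
        have := isLeft_eq_of_reachable (fun w => f (i, w)) (fun x y hxy => hadj (i, x) (i, y)
          ⟨rfl, hxy⟩) (hH.preconnected w w')
        rw [← Sum.isLeft_iff] at hx
        simp only [this, Bool.not_eq_true, Sum.isLeft_eq_false] at hx
        exact hx
      choose g hg using hr
      refine hblue () ⟨⟨⟨g, fun {x y} hxy => ?_⟩, fun x y hxy => ?_⟩⟩
      · have := hadj (i, x) (i, y) ⟨rfl, hxy⟩
        rwa [hg, hg, sum_adj_inr] at this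
      · have : ((i, x) : Fin n × W) = (i, y) := hf (by rw [hg, hg]; exact congrArg _ hxy)
        exact congrArg Prod.snd this
    choose g hg using hl
    have := Fintype.card_le_of_injective g (fun x y hxy => hf (by rw [hg, hg, hxy]))
    simp at this
    omega

/-! ### Tilings and gadgets -/

/-- `T` is the vertex set of a copy of `H` in `B`. -/
def IsTile {α W : Type*} (H : SimpleGraph W) (B : SimpleGraph α) (T : Finset α) : Prop :=
  ∃ f : W → α, Function.Injective f ∧ (∀ x y, H.Adj x y → B.Adj (f x) (f y)) ∧
    (T : Set α) = Set.range f

/-- `S` is the union of disjoint vertex sets of copies of `H` in `B`. -/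
inductive Tiled {α W : Type*} [DecidableEq α] (H : SimpleGraph W) (B : SimpleGraph α) :
    Finset α → Prop
  | empty : Tiled H B ∅
  | union {S T : Finset α} : Tiled H B S → IsTile H B T → Disjoint S T → Tiled H B (S ∪ T)

/-- `U` becomes tiled by the addition of any one element of `O`. -/
def Gadget {α W : Type*} [DecidableEq α] (H : SimpleGraph W) (B : SimpleGraph α)
    (U O : Finset α) : Prop :=
  Disjoint U O ∧ ∀ o ∈ O, Tiled H B (insert o U)

section Tilings

variable {α W : Type*} [DecidableEq α] {H : SimpleGraph W} {B : SimpleGraph α}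

theorem IsTile.card_eq [Fintype W] {T : Finset α} (h : IsTile H B T) : T.card = Fintype.card W := by
  obtain ⟨f, hf, -, hT⟩ := h
  have : T = Finset.univ.image f := by
    ext x
    rw [← Finset.mem_coe, hT]
    simp
  rw [this, Finset.card_image_of_injective _ hf, Finset.card_univ]

theorem IsTile.tiled {T : Finset α} (h : IsTile H B T) : Tiled H B T := by
  simpa using Tiled.empty.union h (Finset.disjoint_empty_left T)

theorem Tiled.disjoint_union {S T : Finset α} (hS : Tiled H B S) (hT : Tiled H B T)
    (hST : Disjoint S T) : Tiled H B (S ∪ T) := by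
  induction hT with
  | empty => simpa using hS
  | union _ hT' _ ih =>
    rw [Finset.disjoint_union_right] at hST
    rw [← Finset.union_assoc]
    refine (ih hST.1).union hT' ?_
    rw [Finset.disjoint_union_left]
    exact ⟨hST.2, by assumption⟩

theorem EmbedsIn.exists_isTile [Fintype W] {s : Finset α} (h : EmbedsIn H B s) :
    ∃ T ⊆ s, IsTile H B T := by
  obtain ⟨f, hf, hadj, hs⟩ := h
  exact ⟨Finset.univ.image f, by simpa [Finset.image_subset_iff] using hs, f, hf, hadj, by simp⟩

/-- A tiled set of order at least `n * |H|` contains `n` disjoint copies of `H`. -/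
theorem Tiled.exists_embedsIn [Fintype W] {S : Finset α} (h : Tiled H B S) :
    ∃ n, S.card = n * Fintype.card W ∧ EmbedsIn (disjointCopies n H) B S := by
  induction h with
  | empty => exact ⟨0, by simp, fun x => x.1.elim0, fun x => x.1.elim0, fun x => x.1.elim0,
      fun x => x.1.elim0⟩
  | @union S T _ hT hST ih =>
    obtain ⟨n, hn, f, hf, hadj, hfS⟩ := ih
    refine ⟨n + 1, by rw [Finset.card_union_of_disjoint hST, hn, hT.card_eq]; ring, ?_⟩
    obtain ⟨g, hg, gadj, hgT⟩ := hT
    have hgT' : ∀ w, g w ∈ T := fun w => by rw [← Finset.mem_coe, hgT]; exact ⟨w, rfl⟩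
    have hne : ∀ x w, f x ≠ g w := fun x w h =>
      Finset.disjoint_left.mp hST (hfS x) (h ▸ hgT' w)
    refine ⟨fun x => Fin.cases (g x.2) (fun i => f (i, x.2)) x.1, ?_, ?_, ?_⟩
    · rintro ⟨i, x⟩ ⟨j, y⟩
      refine Fin.cases ?_ (fun i => ?_) i <;> refine Fin.cases ?_ (fun j => ?_) j <;> intro h
      · simpa using hg h
      · exact absurd h.symm (hne _ _)
      · exact absurd h (hne _ _)
      · have := hf h
        simpa using this
    · rintro ⟨i, x⟩ ⟨j, y⟩ ⟨hij, hxy⟩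
      obtain rfl : i = j := hij
      refine Fin.cases ?_ (fun i => ?_) i
      · exact gadj _ _ hxy
      · exact hadj _ _ ⟨rfl, hxy⟩
    · rintro ⟨i, x⟩
      refine Fin.cases ?_ (fun i => ?_) i
      · exact Finset.mem_union_right _ (hgT' x)
      · exact Finset.mem_union_left _ (hfS _)

theorem disjointCopies_isContained {m n : ℕ} (hmn : m ≤ n) :
    (disjointCopies m H).IsContained (disjointCopies n H) := by
  refine ⟨⟨⟨fun x => (Fin.castLE hmn x.1, x.2), fun {x y} h => ⟨?_, h.2⟩⟩, ?_⟩⟩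
  · exact congrArg (Fin.castLE hmn) h.1
  · rintro ⟨i, x⟩ ⟨j, y⟩ h
    have h : (Fin.castLE hmn i, x) = (Fin.castLE hmn j, y) := h
    simpa using h

/-- Greedy tiling: if every subset of `S` of order at least `b` contains a tile, then `S` can be
tiled down to a remainder of order less than `b`, and at least `b - |H|` unless no tile is used. -/
theorem exists_tiled_subset [Fintype W] [Nonempty W] {b : ℕ} (S : Finset α)
    (hS : ∀ s ⊆ S, b ≤ s.card → ∃ T ⊆ s, IsTile H B T) :
    ∃ S' ⊆ S, Tiled H B S' ∧ (S \ S').card < b ∧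
      (S' = ∅ ∨ b ≤ (S \ S').card + Fintype.card W) := by
  induction hc : S.card using Nat.strong_induction_on generalizing S with
  | _ c ih =>
    by_cases hlt : S.card < b
    · exact ⟨∅, by simp, Tiled.empty, by simpa using hlt, Or.inl rfl⟩
    · obtain ⟨T, hTS, hT⟩ := hS S subset_rfl (by omega)
      have hcT := Finset.card_sdiff_add_card_eq_card hTS
      have h1 := hT.card_eq
      have h2 : 0 < Fintype.card W := Fintype.card_pos
      obtain ⟨S', hS', hS't, h3, h4⟩ := ih _ (by omega : (S \ T).card < c) (S \ T)
        (fun s hs => hS s (hs.trans Finset.sdiff_subset)) rfl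
      have hd : Disjoint S' T := Finset.disjoint_of_subset_left hS' Finset.sdiff_disjoint
      refine ⟨S' ∪ T, Finset.union_subset (hS'.trans Finset.sdiff_subset) hTS, hS't.union hT hd, ?_⟩
      rw [Finset.union_comm, show S \ (T ∪ S') = (S \ T) \ S' from sdiff_sdiff_left.symm]
      refine ⟨h3, Or.inr ?_⟩
      rcases h4 with rfl | h4
      · rw [Finset.sdiff_empty]
        omega
      · exact h4

theorem Gadget.mono {U O O' : Finset α} (h : Gadget H B U O) (hO : O' ⊆ O) : Gadget H B U O' :=
  ⟨Finset.disjoint_of_subset_right hO h.1, fun o ho => h.2 o (hO ho)⟩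

/-- The vertex `w` is a token: whichever of the two gadgets does not receive the added vertex
receives `w` instead. -/
theorem Gadget.compose {U₁ U₂ O₁ O₂ : Finset α} {w : α} (h₁ : Gadget H B U₁ (insert w O₁))
    (h₂ : Gadget H B U₂ (insert w O₂)) (hU : Disjoint U₁ U₂) (h₁₂ : Disjoint U₁ O₂)
    (h₂₁ : Disjoint U₂ O₁) (hw₁ : w ∉ O₁) (hw₂ : w ∉ O₂) :
    Gadget H B (insert w (U₁ ∪ U₂)) (O₁ ∪ O₂) := by
  obtain ⟨d₁, t₁⟩ := h₁
  obtain ⟨d₂, t₂⟩ := h₂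
  rw [Finset.disjoint_insert_right] at d₁ d₂
  refine ⟨?_, fun o ho => ?_⟩
  · simp only [Finset.disjoint_insert_left, Finset.disjoint_union_left,
      Finset.disjoint_union_right]
    tauto
  · rcases Finset.mem_union.mp ho with ho | ho
    · have := (t₁ o (Finset.mem_insert_of_mem ho)).disjoint_union (t₂ w (Finset.mem_insert_self _ _))
        (by
          have ho₂ : o ∉ U₂ := Finset.disjoint_right.mp h₂₁ ho
          have how : o ≠ w := fun h => hw₁ (h ▸ ho)
          simp only [Finset.disjoint_insert_left, Finset.disjoint_insert_right, Finset.mem_insert]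
          tauto)
      convert this using 1
      ext x; simp; tauto
    · have := (t₂ o (Finset.mem_insert_of_mem ho)).disjoint_union (t₁ w (Finset.mem_insert_self _ _))
        (by
          have ho₂ : o ∉ U₁ := Finset.disjoint_right.mp h₁₂ ho
          have how : o ≠ w := fun h => hw₂ (h ▸ ho)
          simp only [Finset.disjoint_insert_left, Finset.disjoint_insert_right, Finset.mem_insert]
          have := hU.symm
          tauto)
      convert this using 1
      ext x; simp; tauto

/-- If the vertices of `P` are adjacent to all of `O` and `P` contains a tile, then removing a vertex
from this tile gives a gadget for `O`. -/
theorem exists_gadget_of_isTile [Fintype W] [Nonempty W] {P O T : Finset α} (hTP : T ⊆ P)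
    (hT : IsTile H B T) (hPO : ∀ x ∈ O, ∀ p ∈ P, B.Adj x p) :
    ∃ X ⊆ P, X.card + 1 = Fintype.card W ∧ Gadget H B X O := by
  classical
  have hc := hT.card_eq
  obtain ⟨f, hf, hadj, hfT⟩ := hT
  have hfT' : ∀ w, f w ∈ T := fun w => by rw [← Finset.mem_coe, hfT]; exact ⟨w, rfl⟩
  let a : W := Classical.arbitrary W
  refine ⟨T.erase (f a), (Finset.erase_subset _ _).trans hTP, ?_, ?_, fun o ho => ?_⟩
  · rw [← hc, Finset.card_erase_add_one (hfT' a)]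
  · rw [Finset.disjoint_left]
    intro x hx hxO
    exact (hPO x hxO x (hTP (Finset.mem_of_mem_erase hx))).ne rfl
  · have hoT : ∀ w, o ≠ f w := fun w => (hPO o ho _ (hTP (hfT' w))).ne
    have hw : ∀ w, B.Adj o (f w) := fun w => hPO o ho _ (hTP (hfT' w))
    -- Since `o` is adjacent to every vertex of the tile, it can take over the role of the removed
    -- vertex.
    refine IsTile.tiled ⟨Function.update f a o, ?_, ?_, ?_⟩
    · intro x y
      by_cases hx : x = a <;> by_cases hy : y = a <;>
        simp +contextual [Function.update_of_ne, hx, hy, hoT, (hoT _).symm, hf.eq_iff]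
    · intro x y hxy
      by_cases hx : x = a <;> by_cases hy : y = a
      · exact absurd (hx.trans hy.symm) hxy.ne
      · simp [hx, hy, hw]
      · simp [hx, hy, (hw _).symm]
      · simp [hx, hy, hadj _ _ hxy]
    · ext x
      simp only [Finset.coe_insert, Finset.coe_erase, hfT, Set.mem_insert_iff, Set.mem_sdiff,
        Set.mem_range, Set.mem_singleton_iff]
      constructor
      · rintro (rfl | ⟨⟨y, rfl⟩, hy⟩)
        · exact ⟨a, by simp⟩
        · have : y ≠ a := fun h => hy (h ▸ rfl)
          exact ⟨y, by simp [this]⟩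
      · rintro ⟨y, rfl⟩
        by_cases hy : y = a
        · left; simp [hy]
        · right; simp [hy, hf.eq_iff]

end Tilings

/-! ### Independence numbers and robust connectivity -/

section Independence

variable {α : Type*} [DecidableEq α]

/-- A set in which all degrees are less than `δ` contains an independent set of order `j` if its
order is at least `j * δ`. -/
theorem exists_isIndepSet_of_degree_lt (B : SimpleGraph α) [DecidableRel B.Adj] {δ : ℕ} (hδ : 0 < δ)
    (j : ℕ) (S : Finset α) (hS : ∀ v ∈ S, (S.filter (B.Adj v)).card < δ) (hj : j * δ ≤ S.card) :
    ∃ I ⊆ S, I.card = j ∧ B.IsIndepSet (I : Set α) := by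
  induction j generalizing S with
  | zero => exact ⟨∅, by simp, by simp, by simp⟩
  | succ j ih =>
    obtain ⟨v, hv⟩ : S.Nonempty := Finset.card_pos.mp (by nlinarith)
    obtain ⟨I, hIS, hI, hind⟩ := ih ((S.erase v).filter (fun w => ¬ B.Adj v w)) (fun w hw => by
        have hwS := Finset.mem_of_mem_erase (Finset.mem_filter.mp hw).1
        refine lt_of_le_of_lt (Finset.card_le_card ?_) (hS w hwS)
        exact Finset.filter_subset_filter _ ((Finset.filter_subset _ _).trans
          (Finset.erase_subset _ _))) (by
        have h1 := Finset.card_filter_add_card_filter_not (s := S.erase v) (B.Adj v)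
        have h2 : ((S.erase v).filter (B.Adj v)).card ≤ (S.filter (B.Adj v)).card :=
          Finset.card_le_card (Finset.filter_subset_filter _ (Finset.erase_subset _ _))
        have h3 := hS v hv
        have h4 := Finset.card_erase_add_one hv
        have h5 : (j + 1) * δ = j * δ + δ := by ring
        omega)
    have hvI : v ∉ I := fun h => by simpa using hIS h
    refine ⟨insert v I, ?_, by simp [hvI, hI], ?_⟩
    · exact Finset.insert_subset hv (hIS.trans ((Finset.filter_subset _ _).trans
        (Finset.erase_subset _ _)))
    · rw [Finset.coe_insert]
      refine Set.Pairwise.insert hind fun w hw _ => ?_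
      have := (Finset.mem_filter.mp (hIS hw)).2
      exact ⟨this, fun h => this h.symm⟩

open Classical in
/-- The largest order of an independent subset of `S`. -/
noncomputable def indepNumOn (Γ : SimpleGraph α) (S : Finset α) : ℕ :=
  (S.powerset.filter (fun I : Finset α => Γ.IsIndepSet (I : Set α))).sup Finset.card

theorem card_le_indepNumOn {Γ : SimpleGraph α} {S I : Finset α} (hI : I ⊆ S)
    (h : Γ.IsIndepSet (I : Set α)) : I.card ≤ indepNumOn Γ S :=
  Finset.le_sup (f := Finset.card) (by simp [hI, h])

theorem exists_card_eq_indepNumOn (Γ : SimpleGraph α) (S : Finset α) :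
    ∃ I ⊆ S, Γ.IsIndepSet (I : Set α) ∧ I.card = indepNumOn Γ S := by
  classical
  obtain ⟨I, hI, h⟩ := Finset.exists_mem_eq_sup
    (S.powerset.filter (fun I : Finset α => Γ.IsIndepSet (I : Set α))) ⟨∅, by simp⟩ Finset.card
  simp only [Finset.mem_filter, Finset.mem_powerset] at hI
  exact ⟨I, hI.1, hI.2, by rw [indepNumOn, ← h]⟩

theorem indepNumOn_pos (Γ : SimpleGraph α) {S : Finset α} (hS : S.Nonempty) :
    0 < indepNumOn Γ S := by
  obtain ⟨x, hx⟩ := hS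
  exact card_le_indepNumOn (Γ := Γ) (S := S) (I := {x}) (by simpa using hx) (by simp)

theorem indepNumOn_add_le {Γ : SimpleGraph α} {S S₁ S₂ : Finset α} (h₁ : S₁ ⊆ S) (h₂ : S₂ ⊆ S)
    (hd : Disjoint S₁ S₂) (hΓ : ∀ x ∈ S₁, ∀ y ∈ S₂, ¬ Γ.Adj x y) :
    indepNumOn Γ S₁ + indepNumOn Γ S₂ ≤ indepNumOn Γ S := by
  obtain ⟨I₁, hI₁, hi₁, hc₁⟩ := exists_card_eq_indepNumOn Γ S₁
  obtain ⟨I₂, hI₂, hi₂, hc₂⟩ := exists_card_eq_indepNumOn Γ S₂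
  rw [← hc₁, ← hc₂, ← Finset.card_union_of_disjoint
    (Finset.disjoint_of_subset_left hI₁ (Finset.disjoint_of_subset_right hI₂ hd))]
  refine card_le_indepNumOn (Finset.union_subset (hI₁.trans h₁) (hI₂.trans h₂)) ?_
  rw [Finset.coe_union]
  refine (Set.pairwise_union).mpr ⟨hi₁, hi₂, fun x hx y hy _ => ?_⟩
  have := hΓ x (hI₁ hx) y (hI₂ hy)
  exact ⟨this, fun h => this h.symm⟩

/-- A large graph with bounded independence number has a large induced subgraph that stays connected
after the removal of any few vertices. -/
theorem exists_robust_cluster (Γ : SimpleGraph α) {a t : ℕ} (ht : 0 < t) (S : Finset α)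
    (hS : indepNumOn Γ S ≤ a) (hcard : 3 * t * a ≤ S.card) (hne : S.Nonempty) :
    ∃ Q ⊆ S, 2 * t ≤ Q.card ∧ ∀ D : Finset α, D.card ≤ t → ∀ Q₁ ⊆ Q \ D, Q₁.Nonempty →
      ((Q \ D) \ Q₁).Nonempty → ∃ x ∈ Q₁, ∃ y ∈ (Q \ D) \ Q₁, Γ.Adj x y := by
  classical
  -- Take the least j for which some set has independence number at most j and order at least 3tj -
  -- t. If deleting t vertices left a disconnected set, its two sides would have independence
  -- numbers j₁ + j₂ ≤ j, both positive. By minimality their orders would sum to less than 3tj - 2t,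
  -- too few.
  let P : ℕ → Prop := fun j => 1 ≤ j ∧ ∃ Q ⊆ S, 3 * t * j ≤ Q.card + t ∧ indepNumOn Γ Q ≤ j
  have hP : ∃ j, P j := ⟨a, (indepNumOn_pos Γ hne).trans_le hS, S, subset_rfl, by omega, hS⟩
  obtain ⟨hj1, Q, hQS, hQ, hαQ⟩ := Nat.find_spec hP
  set j := Nat.find hP with hj
  refine ⟨Q, hQS, by nlinarith, fun D hD Q₁ hQ₁ hne₁ hne₂ => ?_⟩
  by_contra! hno
  have hadd := indepNumOn_add_le (S := Q) (hQ₁.trans Finset.sdiff_subset)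
    ((Finset.sdiff_subset (s := Q \ D) (t := Q₁)).trans Finset.sdiff_subset)
    Finset.disjoint_sdiff hno
  have hp₁ := indepNumOn_pos Γ hne₁
  have hp₂ := indepNumOn_pos Γ hne₂
  have hlt : ∀ Q' ⊆ Q, 0 < indepNumOn Γ Q' → indepNumOn Γ Q' < j →
      Q'.card + t < 3 * t * indepNumOn Γ Q' := fun Q' hQ' hpos hlt' => by
    have := Nat.find_min hP hlt'
    by_contra! hcon
    exact this ⟨hpos, Q', hQ'.trans hQS, hcon, le_rfl⟩
  have h₁ := hlt Q₁ (hQ₁.trans Finset.sdiff_subset) hp₁ (by omega)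
  have h₂ := hlt ((Q \ D) \ Q₁) (Finset.sdiff_subset.trans Finset.sdiff_subset) hp₂ (by omega)
  have h₃ := Finset.card_sdiff_add_card_eq_card hQ₁
  have h₄ := Finset.le_card_sdiff D Q
  have h₅ : 3 * t * indepNumOn Γ Q₁ + 3 * t * indepNumOn Γ ((Q \ D) \ Q₁) ≤ 3 * t * j := by
    rw [← mul_add]
    exact Nat.mul_le_mul_left _ (hadd.trans hαQ)
  omega

end Independence

/-! ### Short paths -/

section Paths

variable {α : Type*} {Γ : SimpleGraph α} {u v : α}

theorem not_adj_getVert_of_length_eq_dist (p : Γ.Walk u v) (hp : p.length = Γ.dist u v) {i j : ℕ}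
    (hij : i + 1 < j) (hj : j ≤ p.length) : ¬ Γ.Adj (p.getVert i) (p.getVert j) := by
  intro h
  have := Γ.dist_le (((p.take i).concat h).append (p.drop j))
  rw [Walk.length_append, Walk.length_concat, Walk.take_length, Walk.drop_length] at this
  omega

/-- A shortest path is at most twice as long as the largest independent sets of its vertices. -/
theorem length_lt_of_length_eq_dist (p : Γ.Walk u v) (hp : p.length = Γ.dist u v) {a : ℕ}
    (ha : ∀ I : Finset α, (∀ x ∈ I, x ∈ p.support) → Γ.IsIndepSet (I : Set α) → I.card < a) :
    p.length < 2 * a := by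
  classical
  by_contra! hlen
  have hpath := p.isPath_of_length_eq_dist hp
  -- The vertices at even positions are independent, since a chord would shorten the path.
  refine (ha ((Finset.range a).image (fun i => p.getVert (2 * i))) ?_ ?_).ne ?_
  · intro x hx
    obtain ⟨i, -, rfl⟩ := Finset.mem_image.mp hx
    exact p.getVert_mem_support _
  · intro x hx y hy hne hxy
    obtain ⟨i, hi, rfl⟩ := Finset.mem_image.mp (Finset.mem_coe.mp hx)
    obtain ⟨j, hj, rfl⟩ := Finset.mem_image.mp (Finset.mem_coe.mp hy)
    rw [Finset.mem_range] at hi hj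
    rcases lt_trichotomy i j with h | rfl | h
    · exact not_adj_getVert_of_length_eq_dist p hp (by omega) (by omega) hxy
    · exact hne rfl
    · exact not_adj_getVert_of_length_eq_dist p hp (by omega) (by omega) hxy.symm
  · rw [Finset.card_image_of_injOn, Finset.card_range]
    intro i hi j hj hij
    simp only [Finset.coe_range, Set.mem_Iio] at hi hj
    have := hpath.getVert_injOn (by simp; omega) (by simp; omega) hij
    omega

variable [DecidableEq α]

/-- In a robust cluster, any two vertices are joined by a short path that avoids a given small
set. -/
theorem exists_short_path (Γ : SimpleGraph α) {a : ℕ} (S : Finset α)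
    (hα : indepNumOn Γ S < a)
    (hS : ∀ S₁ ⊆ S, S₁.Nonempty → (S \ S₁).Nonempty → ∃ x ∈ S₁, ∃ y ∈ S \ S₁, Γ.Adj x y)
    {u v : α} (hu : u ∈ S) (hv : v ∈ S) :
    ∃ p : Γ.Walk u v, p.IsPath ∧ (∀ x ∈ p.support, x ∈ S) ∧ p.length ≤ 2 * a := by
  classical
  -- Distances are measured inside `S`, so that a shortest path stays in `S`.
  let Γ' : SimpleGraph α :=
    { Adj := fun x y => Γ.Adj x y ∧ x ∈ S ∧ y ∈ S
      symm := ⟨fun x y h => ⟨h.1.symm, h.2.2, h.2.1⟩⟩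
      loopless := ⟨fun x h => h.1.ne rfl⟩ }
  have hle : Γ' ≤ Γ := fun x y h => h.1
  have hreach : Γ'.Reachable u v := by
    by_contra hnot
    obtain ⟨x, hx, y, hy, hxy⟩ := hS (S.filter (Γ'.Reachable u)) (Finset.filter_subset _ _)
      ⟨u, by simp [hu]⟩ ⟨v, by simp [hv, hnot]⟩
    simp only [Finset.mem_filter, Finset.mem_sdiff, not_and] at hx hy
    exact hy.2 hy.1 (hx.2.trans (SimpleGraph.Adj.reachable (show Γ'.Adj x y from ⟨hxy, hx.1, hy.1⟩)))
  obtain ⟨p, hp, hlen⟩ := hreach.exists_path_of_dist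
  have hsupp : ∀ {u v : α} (q : Γ'.Walk u v), u ∈ S → ∀ x ∈ q.support, x ∈ S := by
    intro u v q
    induction q with
    | nil => intro hu x hx; simpa using (by simpa using hx : x = _) ▸ hu
    | cons h q ih =>
      intro hu x hx
      rw [Walk.support_cons, List.mem_cons] at hx
      rcases hx with rfl | hx
      · exact hu
      · exact ih h.2.2 x hx
  have hlt := length_lt_of_length_eq_dist p hlen (a := a) (fun I hI hind => by
    refine lt_of_le_of_lt (card_le_indepNumOn (Γ := Γ) (S := S) (fun x hx => hsupp p hu x (hI x hx))
      fun x hx y hy hne hxy => ?_) hα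
    exact hind hx hy hne ⟨hxy, hsupp p hu x (hI x hx), hsupp p hu y (hI y hy)⟩)
  refine ⟨p.mapLe hle, ?_, ?_, ?_⟩
  · simpa using hp
  · intro x hx
    exact hsupp p hu x (by simpa using hx)
  · simpa using hlt.le

end Paths

/-! ### Common neighbours and the existence of clusters -/

section CommonNeighbours

variable {α : Type*} [Fintype α] [DecidableEq α]

open Classical in
/-- The common neighbours of the vertices in `O`. -/
noncomputable def commonNbrs (B : SimpleGraph α) (O : Finset α) : Finset α :=
  Finset.univ.filter (fun p => ∀ x ∈ O, B.Adj x p)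

theorem mem_commonNbrs {B : SimpleGraph α} {O : Finset α} {p : α} :
    p ∈ commonNbrs B O ↔ ∀ x ∈ O, B.Adj x p := by simp [commonNbrs]

theorem commonNbrs_anti {B : SimpleGraph α} {O O' : Finset α} (h : O' ⊆ O) :
    commonNbrs B O ⊆ commonNbrs B O' := fun p hp => by
  rw [mem_commonNbrs] at hp ⊢
  exact fun x hx => hp x (h hx)

open Classical in
/-- The vertices whose degree is at least `1 / (2 * k)` of the order. -/
noncomputable def highDegree (B : SimpleGraph α) (k : ℕ) : Finset α :=
  Finset.univ.filter (fun v => Fintype.card α ≤ 2 * k * (commonNbrs B {v}).card)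

theorem mem_highDegree {B : SimpleGraph α} {k : ℕ} {v : α} :
    v ∈ highDegree B k ↔ Fintype.card α ≤ 2 * k * (commonNbrs B {v}).card := by
  simp [highDegree]

/-- If more than half of the vertices, plus k, had low degree, a greedy choice among them would give
an independent set of order k. -/
theorem card_le_card_highDegree (B : SimpleGraph α) {k : ℕ} (hk : 0 < k)
    (hB : ∀ I : Finset α, I.card = k → ¬ B.IsIndepSet (I : Set α)) :
    Fintype.card α ≤ 2 * ((highDegree B k).card + k) := by
  classical
  by_contra! hlt
  have hc := Finset.card_add_card_compl (highDegree B k)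
  have hdiv : k * (Fintype.card α / (2 * k)) ≤ Fintype.card α / 2 := by
    rw [Nat.le_div_iff_mul_le two_pos, mul_comm, ← mul_assoc]
    exact Nat.mul_div_le _ _
  obtain ⟨I, -, hI, hind⟩ := exists_isIndepSet_of_degree_lt B
    (δ := Fintype.card α / (2 * k) + 1) (Nat.succ_pos _) k (highDegree B k)ᶜ (fun v hv => by
      rw [Finset.mem_compl, mem_highDegree, not_le] at hv
      rw [Nat.lt_succ_iff, Nat.le_div_iff_mul_le (by omega), mul_comm]
      refine le_trans (Nat.mul_le_mul_left _ (Finset.card_le_card fun w hw => ?_)) hv.le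
      rw [mem_commonNbrs]
      simpa using (Finset.mem_filter.mp hw).2) (by
      rw [mul_add, mul_one]
      omega)
  exact hB I hI hind

/-- Among any `8 * k` vertices of high degree there are three with many common neighbours. -/
theorem exists_triple (B : SimpleGraph α) {k M : ℕ} (hk : 0 < k)
    (hM : 2 ^ 11 * k ^ 4 * M ≤ Fintype.card α) (S : Finset α) (hS : S ⊆ highDegree B k)
    (hc : S.card = 8 * k) : ∃ t ⊆ S, t.card = 3 ∧ M ≤ (commonNbrs B t).card := by
  classical
  by_contra! hno
  set N := Fintype.card α with hN
  have hdouble := Finset.sum_card_bipartiteAbove_eq_sum_card_bipartiteBelow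
    (s := S) (t := (Finset.univ : Finset α)) B.Adj
  have hlow : S.card * N ≤ 2 * k * ∑ x ∈ S, (Finset.univ.bipartiteAbove B.Adj x).card := by
    rw [Finset.mul_sum]
    refine Finset.card_nsmul_le_sum _ _ _ fun x hx => ?_
    refine (mem_highDegree.mp (hS hx)).trans (Nat.mul_le_mul_left _ (Finset.card_le_card ?_))
    intro p hp
    simpa [mem_commonNbrs, Finset.bipartiteAbove] using hp
  -- The 8k vertices send at least 4N edges in all, so at least N/(4k) vertices have three
  -- neighbours in `S`. There are at most (8k)³ triples, whence the factor 2¹¹k⁴.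
  let Y : Finset α := Finset.univ.filter (fun w => 3 ≤ (S.bipartiteBelow B.Adj w).card)
  have hup : ∑ w, (S.bipartiteBelow B.Adj w).card ≤ 2 * N + 8 * k * Y.card := by
    calc ∑ w, (S.bipartiteBelow B.Adj w).card
        ≤ ∑ w : α, (2 + if w ∈ Y then 8 * k else 0) := by
          refine Finset.sum_le_sum fun w _ => ?_
          by_cases hw : w ∈ Y
          · rw [if_pos hw, ← hc]
            exact (Finset.card_le_card (Finset.filter_subset _ _)).trans (Nat.le_add_left _ _)
          · have : ¬ 3 ≤ (S.bipartiteBelow B.Adj w).card := by simpa [Y] using hw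
            rw [if_neg hw]
            omega
      _ = 2 * N + 8 * k * Y.card := by
          rw [Finset.sum_add_distrib, Finset.sum_ite_mem]
          simp [hN, mul_comm]
  have hY : Y.card ≤ (8 * k) ^ 3 * (M - 1) := by
    calc Y.card ≤ ((S.powersetCard 3).biUnion (commonNbrs B)).card := by
          refine Finset.card_le_card fun w hw => ?_
          obtain ⟨t, ht, htc⟩ := Finset.exists_subset_card_eq (Finset.mem_filter.mp hw).2
          rw [Finset.mem_biUnion]
          refine ⟨t, by simp [Finset.mem_powersetCard, htc, ht.trans (Finset.filter_subset _ _)], ?_⟩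
          rw [mem_commonNbrs]
          exact fun x hx => (Finset.mem_filter.mp (ht hx)).2
      _ ≤ (S.powersetCard 3).card * (M - 1) := Finset.card_biUnion_le_card_mul _ _ _ fun t ht => by
          rw [Finset.mem_powersetCard] at ht
          have := hno t ht.1 ht.2
          omega
      _ ≤ (8 * k) ^ 3 * (M - 1) := by
          rw [Finset.card_powersetCard, hc]
          exact Nat.mul_le_mul_right _ (Nat.choose_le_pow _ _)
  have hMpos : 0 < M := by
    obtain ⟨t, ht, htc⟩ := Finset.exists_subset_card_eq (show 3 ≤ S.card by omega)
    exact (Nat.zero_le _).trans_lt (hno t ht htc)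
  obtain ⟨M', rfl⟩ : ∃ M', M = M' + 1 := ⟨M - 1, by omega⟩
  rw [Nat.add_sub_cancel] at hY
  rw [hdouble, hc] at hlow
  have h1 : 8 * k * N ≤ 2 * k * (2 * N + 8 * k * Y.card) := hlow.trans (Nat.mul_le_mul_left _ hup)
  have h2 : N ≤ 4 * k * Y.card := by
    have : (4 * k) * N ≤ (4 * k) * (4 * k * Y.card) := by linarith
    exact Nat.le_of_mul_le_mul_left this (by omega)
  have h3 : 4 * k * Y.card ≤ 4 * k * ((8 * k) ^ 3 * M') := Nat.mul_le_mul_left _ hY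
  have h4 : 0 < k ^ 4 := by positivity
  nlinarith

/-- Vertices are linked if they have at least `M` common neighbours. -/
def linkGraph (B : SimpleGraph α) (M : ℕ) : SimpleGraph α where
  Adj u v := u ≠ v ∧ M ≤ (commonNbrs B {u, v}).card
  symm := ⟨fun u v h => ⟨h.1.symm, by rw [Finset.pair_comm]; exact h.2⟩⟩
  loopless := ⟨fun u h => h.1 rfl⟩

theorem indepNumOn_linkGraph_lt (B : SimpleGraph α) {k M : ℕ} (hk : 0 < k)
    (hM : 2 ^ 11 * k ^ 4 * M ≤ Fintype.card α) :
    indepNumOn (linkGraph B M) (highDegree B k) < 8 * k := by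
  by_contra! hle
  obtain ⟨I, hI, hind, hc⟩ := exists_card_eq_indepNumOn (linkGraph B M) (highDegree B k)
  obtain ⟨S, hS, hSc⟩ := Finset.exists_subset_card_eq (hle.trans hc.ge)
  obtain ⟨t, ht, htc, htM⟩ := exists_triple B hk hM S (hS.trans hI) hSc
  obtain ⟨x, y, z, hxy, -, -, rfl⟩ := Finset.card_eq_three.mp htc
  refine hind (hS (ht (by simp))) (hS (ht (by simp : y ∈ _))) hxy ⟨hxy, htM.trans ?_⟩
  exact Finset.card_le_card (commonNbrs_anti (by intro; simp; tauto))

end CommonNeighbours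

/-- A set of vertices that stays connected by short paths of linked vertices, and keeps triples with
many common neighbours, after the removal of any `t` vertices. -/
structure IsCluster {α : Type*} [Fintype α] [DecidableEq α] (B : SimpleGraph α) (M t l : ℕ)
    (Q : Finset α) : Prop where
  card_le : 2 * t ≤ Q.card
  exists_path : ∀ D : Finset α, D.card ≤ t → ∀ u ∈ Q \ D, ∀ v ∈ Q \ D,
    ∃ p : (linkGraph B M).Walk u v, p.IsPath ∧ (∀ x ∈ p.support, x ∈ Q \ D) ∧ p.length ≤ l
  exists_triple : ∀ D : Finset α, D.card ≤ t → ∃ x y z, x ≠ y ∧ x ≠ z ∧ y ≠ z ∧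
    x ∈ Q \ D ∧ y ∈ Q \ D ∧ z ∈ Q \ D ∧ M ≤ (commonNbrs B {x, y, z}).card

/-- The high-degree vertices number at least 24kt, and their link graph has independence number
below 8k, so a robust cluster exists among them. Shortest paths then have length at most 2 · 8k, and
the t ≥ 8k vertices surviving a deletion contain a triple. -/
theorem exists_isCluster {α : Type*} [Fintype α] [DecidableEq α] (B : SimpleGraph α) {k M t : ℕ}
    (hk : 0 < k) (hB : ∀ I : Finset α, I.card = k → ¬ B.IsIndepSet (I : Set α))
    (hM : 2 ^ 11 * k ^ 4 * M ≤ Fintype.card α) (ht : 8 * k ≤ t)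
    (hN : 2 * (3 * t * (8 * k) + k) ≤ Fintype.card α) :
    ∃ Q, IsCluster B M t (16 * k) Q := by
  have hα := indepNumOn_linkGraph_lt B hk hM
  have hV := card_le_card_highDegree B hk hB
  have hpos : 0 < 3 * t * (8 * k) := by
    have : 0 < t := by omega
    positivity
  obtain ⟨Q, hQ, hQc, hconn⟩ := exists_robust_cluster (linkGraph B M) (by omega : 0 < t)
    (highDegree B k) hα.le (by omega) (Finset.card_pos.mp (by omega))
  refine ⟨Q, hQc, fun D hD u hu v hv => ?_, fun D hD => ?_⟩
  · have := exists_short_path (linkGraph B M) (a := 8 * k) (Q \ D) (by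
      obtain ⟨I, hI, hind, hc⟩ := exists_card_eq_indepNumOn (linkGraph B M) (Q \ D)
      rw [← hc]
      exact lt_of_le_of_lt (card_le_indepNumOn ((hI.trans Finset.sdiff_subset).trans hQ) hind) hα)
      (hconn D hD) hu hv
    rwa [← mul_assoc] at this
  · obtain ⟨S, hS, hSc⟩ := Finset.exists_subset_card_eq (s := Q \ D) (n := 8 * k) (by
      have := Finset.le_card_sdiff D Q
      omega)
    obtain ⟨T, hT, hTc, hTM⟩ := exists_triple B hk hM S
      (hS.trans (Finset.sdiff_subset.trans hQ)) hSc
    obtain ⟨x, y, z, hxy, hxz, hyz, rfl⟩ := Finset.card_eq_three.mp hTc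
    exact ⟨x, y, z, hxy, hxz, hyz, hS (hT (by simp)), hS (hT (by simp)), hS (hT (by simp)), hTM⟩

/-! ### Building the absorber -/

section Absorption

variable {α W : Type*} [Fintype α] [DecidableEq α] [Fintype W] [Nonempty W] {H : SimpleGraph W}
  {B : SimpleGraph α} {r t M l : ℕ}

/-- At least r common neighbours of `O` lie outside `D`, and they contain a tile. -/
theorem exists_gadget_avoiding (hr : ∀ s : Finset α, r ≤ s.card → ∃ T ⊆ s, IsTile H B T)
    (htM : t + r ≤ M) {O D : Finset α} (hO : M ≤ (commonNbrs B O).card) (hD : D.card ≤ t) :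
    ∃ X, Disjoint X D ∧ X.card + 1 = Fintype.card W ∧ Gadget H B X O := by
  obtain ⟨T, hT, hTt⟩ := hr (commonNbrs B O \ D) (by
    have := Finset.le_card_sdiff D (commonNbrs B O)
    omega)
  obtain ⟨X, hX, hXc, hXg⟩ := exists_gadget_of_isTile hT hTt (O := O) fun x hx p hp =>
    mem_commonNbrs.mp (Finset.mem_sdiff.mp hp).1 x hx
  exact ⟨X, Finset.disjoint_of_subset_left hX Finset.sdiff_disjoint, hXc, hXg⟩

/-- The end vertices of a path of linked vertices can be exchanged. -/
theorem exists_gadget_of_isPath (hr : ∀ s : Finset α, r ≤ s.card → ∃ T ⊆ s, IsTile H B T)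
    (htM : t + r ≤ M) {u v : α} (p : (linkGraph B M).Walk u v) (hp : p.IsPath) (huv : u ≠ v)
    (D : Finset α) (hD : ∀ x ∈ p.support, x ∉ D)
    (hcard : D.card + p.length * Fintype.card W ≤ t) :
    ∃ U, Disjoint U D ∧ Gadget H B U {u, v} ∧ U.card + 1 ≤ p.length * Fintype.card W := by
  have hW : 0 < Fintype.card W := Fintype.card_pos
  induction p generalizing D with
  | nil => exact absurd rfl huv
  | @cons u w v hadj q ih =>
    rw [Walk.length_cons, add_mul, one_mul] at hcard ⊢
    by_cases hwv : w = v
    · subst hwv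
      obtain ⟨X, hXD, hXc, hX⟩ := exists_gadget_avoiding hr htM hadj.2 (D := D) (by omega)
      exact ⟨X, hXD, hX, by omega⟩
    · rw [Walk.cons_isPath_iff] at hp
      obtain ⟨U, hUD, hU, hUc⟩ := ih hp.1 hwv (insert u D) (fun x hx hxD => by
          rcases Finset.mem_insert.mp hxD with rfl | hxD
          · exact hp.2 hx
          · exact hD x (by simp [hx]) hxD) (by
          have := Finset.card_insert_le u D
          omega)
      obtain ⟨X, hXD, hXc, hX⟩ := exists_gadget_avoiding hr htM hadj.2 (D := insert v (D ∪ U)) (by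
        have := Finset.card_insert_le v (D ∪ U)
        have := Finset.card_union_le D U
        omega)
      have hwD : w ∉ D := hD w (by simp)
      have huw : u ≠ w := hadj.1
      rw [Finset.disjoint_insert_right] at hUD
      rw [Finset.disjoint_insert_right, Finset.disjoint_union_right] at hXD
      refine ⟨insert w (X ∪ U), ?_, ?_, ?_⟩
      · rw [Finset.disjoint_insert_left, Finset.disjoint_union_left]
        exact ⟨hwD, hXD.2.1, hUD.2⟩
      · refine Gadget.compose (w := w) (O₁ := {u}) (O₂ := {v}) ?_ hU hXD.2.2 (by simpa using hXD.1)
          (by simpa using hUD.1) (by simpa using huw.symm) (by simpa using hwv)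
        rwa [Finset.pair_comm] at hX
      · have := Finset.card_insert_le w (X ∪ U)
        have := Finset.card_union_le X U
        omega

theorem IsCluster.exists_swap {Q : Finset α} (hQ : IsCluster B M t l Q)
    (hr : ∀ s : Finset α, r ≤ s.card → ∃ T ⊆ s, IsTile H B T)
    (htM : t + r ≤ M) {u v : α} (hu : u ∈ Q) (hv : v ∈ Q) (huv : u ≠ v) (D : Finset α)
    (hcard : D.card + l * Fintype.card W ≤ t) :
    ∃ U, Disjoint U D ∧ Gadget H B U {u, v} ∧ U.card + 1 ≤ l * Fintype.card W := by
  -- `D` may contain `u` and `v`; a gadget for them avoids them anyway.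
  have hle : (D \ {u, v}).card ≤ D.card := Finset.card_le_card Finset.sdiff_subset
  obtain ⟨p, hp, hps, hpl⟩ := hQ.exists_path (D \ {u, v}) (by omega) u (by simp [hu]) v (by simp [hv])
  have hl := Nat.mul_le_mul_right (Fintype.card W) hpl
  obtain ⟨U, hUD, hU, hUc⟩ := exists_gadget_of_isPath hr htM p hp huv (D \ {u, v})
    (fun x hx => (Finset.mem_sdiff.mp (hps x hx)).2) (by omega)
  refine ⟨U, ?_, hU, by omega⟩
  rw [Finset.disjoint_left]
  intro x hxU hxD
  have h1 := Finset.disjoint_left.mp hUD hxU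
  have h2 := Finset.disjoint_left.mp hU.1 hxU
  exact h1 (Finset.mem_sdiff.mpr ⟨hxD, h2⟩)

/-- In a cluster there are gadgets for all sets of vertices of moderate order. -/
theorem IsCluster.exists_gadget {Q : Finset α} (hQ : IsCluster B M t l Q)
    (hr : ∀ s : Finset α, r ≤ s.card → ∃ T ⊆ s, IsTile H B T)
    (htM : t + r ≤ M) {c : ℕ} (hc : 2 * (l * Fintype.card W) + Fintype.card W + 3 ≤ c) (p : ℕ)
    (O : Finset α) (hO : O ⊆ Q) (hOc : O.card = p + 2) (D : Finset α) (hOD : O ⊆ D)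
    (hcard : D.card + (p + 1) * c ≤ t) :
    ∃ U, Disjoint U D ∧ Gadget H B U O ∧ U.card ≤ (p + 1) * c := by
  induction p generalizing O D with
  | zero =>
    obtain ⟨u, v, huv, rfl⟩ := Finset.card_eq_two.mp hOc
    obtain ⟨U, hUD, hU, hUc⟩ := hQ.exists_swap hr htM (hO (by simp)) (hO (by simp : v ∈ _)) huv D
      (by omega)
    exact ⟨U, hUD, hU, by omega⟩
  | succ p ih =>
    obtain ⟨o₂, O₂, ho₂, rfl, hO₂⟩ := Finset.card_eq_succ.mp hOc
    obtain ⟨o₁, O₁, ho₁, rfl, hO₁⟩ := Finset.card_eq_succ.mp hO₂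
    have hsplit : (p + 1 + 1) * c = (p + 1) * c + c := by ring
    rw [hsplit] at hcard ⊢
    simp only [Finset.insert_subset_iff] at hO hOD
    simp only [Finset.mem_insert, not_or] at ho₂
    -- Composing gadgets for pairs yields only pairs, so a triple is needed to branch. The gadget
    -- `X` for {x, y, z} is composed with swaps of y for `o₁` and z for `o₂`. The result `Z` serves
    -- {x, o₁, o₂}, and x is the token linking it to a gadget for `insert x O₁`.
    obtain ⟨x, y, z, hxy, hxz, hyz, hx, hy, hz, hM⟩ := hQ.exists_triple D (by omega)
    rw [Finset.mem_sdiff] at hx hy hz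
    obtain ⟨X, hXD, hXc, hX⟩ := exists_gadget_avoiding hr htM hM (D := D) (by omega)
    have hne : ∀ {o w}, o ∈ D → w ∉ D → w ≠ o := fun h1 h2 h3 => h2 (h3 ▸ h1)
    obtain ⟨U₁, hU₁D, hU₁, hU₁c⟩ := hQ.exists_swap hr htM hy.1 hO.2.1 (hne hOD.2.1 hy.2)
      (insert x (insert z (D ∪ X))) (by
        have := Finset.card_insert_le x (insert z (D ∪ X))
        have := Finset.card_insert_le z (D ∪ X)
        have := Finset.card_union_le D X
        omega)
    obtain ⟨U₂, hU₂D, hU₂, hU₂c⟩ := hQ.exists_swap hr htM hz.1 hO.1 (hne hOD.1 hz.2)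
      (insert x (insert y (D ∪ X ∪ U₁))) (by
        have := Finset.card_insert_le x (insert y (D ∪ X ∪ U₁))
        have := Finset.card_insert_le y (D ∪ X ∪ U₁)
        have := Finset.card_union_le (D ∪ X) U₁
        have := Finset.card_union_le D X
        omega)
    let Z : Finset α := insert z (insert y (X ∪ U₁) ∪ U₂)
    have hZc : Z.card + 1 ≤ c := by
      change (insert z (insert y (X ∪ U₁) ∪ U₂)).card + 1 ≤ c
      have := Finset.card_insert_le z (insert y (X ∪ U₁) ∪ U₂)
      have := Finset.card_union_le (insert y (X ∪ U₁)) U₂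
      have := Finset.card_insert_le y (X ∪ U₁)
      have := Finset.card_union_le X U₁
      omega
    simp only [Finset.disjoint_insert_right, Finset.disjoint_union_right] at hU₁D hU₂D
    have hXO := hX.1
    have hU₁O := hU₁.1
    have hU₂O := hU₂.1
    simp only [Finset.disjoint_insert_right, Finset.disjoint_singleton_right] at hXO hU₁O hU₂O
    have hmem : ∀ {S : Finset α} {o : α}, Disjoint S D → o ∈ D → o ∉ S := fun h1 h2 =>
      Finset.disjoint_right.mp h1 h2
    have hxo₁ := hne hOD.2.1 hx.2
    have hxo₂ := hne hOD.1 hx.2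
    have hyo₁ := hne hOD.2.1 hy.2
    have hzo₁ := hne hOD.2.1 hz.2
    have hzo₂ := hne hOD.1 hz.2
    have hyo₂ := hne hOD.1 hy.2
    have hZ : Gadget H B Z (insert x {o₁, o₂}) := by
      have h1 : Gadget H B (insert y (X ∪ U₁)) ({x, z} ∪ {o₁}) := by
        refine Gadget.compose (hX.mono (by intro; simp; tauto)) hU₁ hU₁D.2.2.2.symm ?_ ?_ ?_ ?_
        · simpa using hmem hXD hOD.2.1
        · simp only [Finset.disjoint_insert_right, Finset.disjoint_singleton_right]
          exact ⟨hU₁D.1, hU₁D.2.1⟩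
        · simp [hxy.symm, hyz]
        · simpa using hyo₁
      have h2 : Gadget H B Z ({x, o₁} ∪ {o₂}) := by
        refine Gadget.compose (h1.mono (by intro; simp; tauto)) hU₂ ?_ ?_ ?_ ?_ ?_
        · simp only [Finset.disjoint_insert_left, Finset.disjoint_union_left]
          exact ⟨hU₂D.2.1, hU₂D.2.2.1.2.symm, hU₂D.2.2.2.symm⟩
        · simp only [Finset.disjoint_singleton_right, Finset.mem_insert, Finset.mem_union, not_or]
          exact ⟨hyo₂.symm, hmem hXD hOD.1, hmem hU₁D.2.2.1 hOD.1⟩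
        · simp only [Finset.disjoint_insert_right, Finset.disjoint_singleton_right]
          exact ⟨hU₂D.1, hmem hU₂D.2.2.1.1 hOD.2.1⟩
        · simp [hxz.symm, hzo₁]
        · simpa using hzo₂
      exact h2.mono (by intro; simp)
    have hxZ := hZ.1
    rw [Finset.disjoint_insert_right] at hxZ
    have hZD : Disjoint Z D := by
      simp only [Z, Finset.disjoint_insert_left, Finset.disjoint_union_left]
      exact ⟨hz.2, ⟨hy.2, hXD, hU₁D.2.2.1⟩, hU₂D.2.2.1.1⟩
    have hxO₁ : x ∉ O₁ := fun h => hx.2 (hOD.2.2 h)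
    obtain ⟨U, hUD, hU, hUc⟩ := ih (insert x O₁) (Finset.insert_subset hx.1 hO.2.2)
      (by rw [Finset.card_insert_of_notMem hxO₁, hO₁]) (insert x (D ∪ Z))
      (Finset.insert_subset_insert _ (hOD.2.2.trans Finset.subset_union_left)) (by
        have := Finset.card_insert_le x (D ∪ Z)
        have := Finset.card_union_le D Z
        omega)
    rw [Finset.disjoint_insert_right, Finset.disjoint_union_right] at hUD
    refine ⟨insert x (Z ∪ U), ?_, ?_, ?_⟩
    · simp only [Finset.disjoint_insert_left, Finset.disjoint_union_left]
      exact ⟨hx.2, hZD, hUD.2.1⟩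
    · refine (hZ.compose hU hUD.2.2.symm (Finset.disjoint_of_subset_right hOD.2.2 hZD) ?_ ?_
        hxO₁).mono (by intro; simp; tauto)
      · simp only [Finset.disjoint_insert_right, Finset.disjoint_singleton_right]
        exact ⟨hmem hUD.2.1 hOD.2.1, hmem hUD.2.1 hOD.1⟩
      · simp [hxo₁, hxo₂]
    · have := Finset.card_insert_le x (Z ∪ U)
      have := Finset.card_union_le Z U
      omega

/-- A set that becomes tiled by the addition of any `j` elements of `O`. -/
theorem IsCluster.exists_flexible {Q : Finset α} (hQ : IsCluster B M t l Q)
    (hr : ∀ s : Finset α, r ≤ s.card → ∃ T ⊆ s, IsTile H B T)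
    (htM : t + r ≤ M) {c : ℕ} (hc : 2 * (l * Fintype.card W) + Fintype.card W + 3 ≤ c)
    (O : Finset α) (hO : O ⊆ Q) (hO2 : 2 ≤ O.card) (j : ℕ)
    (hcard : O.card + j * (O.card * c) ≤ t) :
    ∃ U, Disjoint U O ∧ U.card ≤ j * (O.card * c) ∧
      ∀ T ⊆ O, T.card = j → Tiled H B (U ∪ T) := by
  induction j with
  | zero =>
    refine ⟨∅, by simp, by simp, fun T _ hT => ?_⟩
    rw [Finset.card_eq_zero.mp hT]
    simpa using Tiled.empty
  | succ j ih =>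
    rw [add_mul, one_mul] at hcard ⊢
    obtain ⟨U, hUO, hUc, hU⟩ := ih (by omega)
    obtain ⟨p, hp⟩ : ∃ p, O.card = p + 2 := ⟨O.card - 2, by omega⟩
    have hpc : (p + 1) * c ≤ O.card * c := Nat.mul_le_mul_right _ (by omega)
    obtain ⟨U', hU'D, hU', hU'c⟩ := hQ.exists_gadget hr htM hc p O hO hp (O ∪ U)
      Finset.subset_union_left (by
        have := Finset.card_union_le O U
        omega)
    rw [Finset.disjoint_union_right] at hU'D
    refine ⟨U ∪ U', ?_, ?_, fun T hT hTc => ?_⟩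
    · rw [Finset.disjoint_union_left]
      exact ⟨hUO, hU'D.1⟩
    · have := Finset.card_union_le U U'
      omega
    -- The new gadget takes one element of `T`, the old set the other j.
    · obtain ⟨o, T', ho, rfl, hT'⟩ := Finset.card_eq_succ.mp hTc
      rw [Finset.insert_subset_iff] at hT
      have h1 := (hU T' hT.2 hT').disjoint_union (hU'.2 o hT.1) (by
        simp only [Finset.disjoint_insert_right, Finset.disjoint_union_left, Finset.mem_union,
          not_or]
        exact ⟨⟨Finset.disjoint_right.mp hUO hT.1, ho⟩, hU'D.2.symm,
          Finset.disjoint_of_subset_left hT.2 hU'D.1.symm⟩)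
      convert h1 using 1
      ext; simp; tauto

end Absorption

/-! ### Covering the vertices outside the absorber -/

/-- Few vertices with many neighbours in `Y` can be covered by tiles whose other vertices are in
`Y`. -/
theorem exists_tiled_cover {α W : Type*} [DecidableEq α] [Fintype W] [Nonempty W]
    {H : SimpleGraph W} {B : SimpleGraph α} {r : ℕ}
    (hr : ∀ s : Finset α, r ≤ s.card → ∃ T ⊆ s, IsTile H B T)
    [DecidableRel B.Adj] (Y L : Finset α) (hLY : Disjoint L Y)
    (hL : ∀ v ∈ L, L.card * Fintype.card W + r ≤ (Y.filter (B.Adj v)).card) :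
    ∃ Y' ⊆ Y, Tiled H B (L ∪ Y') ∧ Y'.card ≤ L.card * Fintype.card W := by
  induction L using Finset.induction_on with
  | empty => exact ⟨∅, by simp, by simpa using Tiled.empty, by simp⟩
  | insert v L hv ih =>
    rw [Finset.disjoint_insert_left] at hLY
    rw [Finset.card_insert_of_notMem hv, add_mul, one_mul] at hL ⊢
    obtain ⟨Y', hY', hT, hc⟩ := ih hLY.2 fun w hw => by
      have := hL w (Finset.mem_insert_of_mem hw)
      omega
    obtain ⟨T, hTs, hTt⟩ := hr (Y.filter (B.Adj v) \ Y') (by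
      have := Finset.le_card_sdiff Y' (Y.filter (B.Adj v))
      have := hL v (Finset.mem_insert_self _ _)
      omega)
    obtain ⟨X, hX, hXc, hXg⟩ := exists_gadget_of_isTile (O := {v}) hTs hTt (by
      intro x hx p hp
      rw [Finset.mem_singleton.mp hx]
      simp only [Finset.mem_sdiff, Finset.mem_filter] at hp
      exact hp.1.2)
    have hXY : X ⊆ Y := hX.trans (Finset.sdiff_subset.trans (Finset.filter_subset _ _))
    refine ⟨Y' ∪ X, Finset.union_subset hY' hXY, ?_, ?_⟩
    · have h1 := hT.disjoint_union (hXg.2 v (by simp)) (by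
        simp only [Finset.disjoint_insert_right, Finset.disjoint_union_left, Finset.mem_union,
          not_or]
        exact ⟨⟨hv, fun h => hLY.1 (hY' h)⟩, Finset.disjoint_of_subset_right hXY hLY.2,
          (Finset.disjoint_of_subset_left hX Finset.sdiff_disjoint).symm⟩)
      convert h1 using 1
      ext; simp
    · have := Finset.card_union_le Y' X
      omega

/-- If each vertex of `S` has few blue neighbours in a large set `Y`, then a red member of `𝒟(G)` in
`S` extends to a red `G`. -/
theorem exists_isTile_of_few_neighbours {V W α : Type*} [Fintype V] [Fintype W] [DecidableEq α]
    {G : SimpleGraph V} {H : SimpleGraph W} (R : SimpleGraph α) [DecidableRel Rᶜ.Adj]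
    (hR : ¬ G.IsContained R) {d b : ℕ}
    (hd : RamseyArrows (deletionFamily G) (singleFamily H) d) (S Y : Finset α)
    (hSY : Disjoint S Y) (hY : Fintype.card V * b + Fintype.card V ≤ Y.card)
    (hS : ∀ v ∈ S, (Y.filter (Rᶜ.Adj v)).card ≤ b) (hc : d ≤ S.card) : ∃ T ⊆ S, IsTile H Rᶜ T := by
  classical
  rcases hd.embedsIn R S hc with ⟨⟨I, hI⟩, f, hf, hadj, hfS⟩ | ⟨_, h⟩
  · exfalso
    -- The vertices of `Y` joined in red to the whole copy of G - I. The colours inside this set do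
    -- not matter, because I is independent.
    let P : Finset α := Y \ Finset.univ.biUnion (fun x : (Iᶜ : Set V) => Y.filter (Rᶜ.Adj (f x)))
    have hP : Fintype.card V ≤ P.card := by
      have h1 := Finset.le_card_sdiff
        (Finset.univ.biUnion (fun x : (Iᶜ : Set V) => Y.filter (Rᶜ.Adj (f x)))) Y
      have h2 := Finset.card_biUnion_le_card_mul Finset.univ
        (fun x : (Iᶜ : Set V) => Y.filter (Rᶜ.Adj (f x))) b (fun x _ => hS _ (hfS x))
      have h3 : (Finset.univ : Finset (Iᶜ : Set V)).card * b ≤ Fintype.card V * b :=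
        Nat.mul_le_mul_right _ (Fintype.card_subtype_le _)
      change _ ≤ P.card at h1
      omega
    obtain ⟨g⟩ : Nonempty (V ↪ P) := Function.Embedding.nonempty_of_card_le (by simpa using hP)
    have hgY : ∀ v, (g v : α) ∈ Y := fun v => (Finset.mem_sdiff.mp (g v).2).1
    have hfg : ∀ x v, f x ≠ g v := fun x v h => Finset.disjoint_left.mp hSY (hfS x) (h ▸ hgY v)
    have hred : ∀ x v, R.Adj (f x) (g v) := fun x v => by
      by_contra h
      refine (Finset.mem_sdiff.mp (g v).2).2 (Finset.mem_biUnion.mpr ⟨x, Finset.mem_univ _, ?_⟩)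
      exact Finset.mem_filter.mpr ⟨hgY v, by rw [compl_adj]; exact ⟨hfg x v, h⟩⟩
    refine hR ⟨⟨⟨fun v => if h : v ∈ I then (g v : α) else f ⟨v, h⟩, fun {x y} hxy => ?_⟩, ?_⟩⟩
    · by_cases hx : x ∈ I <;> by_cases hy : y ∈ I
      · exact absurd hxy (hI.1 hx hy hxy.ne)
      · simpa [hx, hy] using (hred _ _).symm
      · simpa [hx, hy] using hred _ _
      · simpa [hx, hy] using hadj ⟨x, hx⟩ ⟨y, hy⟩ hxy
    · intro x y hxy
      change (if h : x ∈ I then (g x : α) else f ⟨x, h⟩) =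
        (if h : y ∈ I then (g y : α) else f ⟨y, h⟩) at hxy
      by_cases hx : x ∈ I <;> by_cases hy : y ∈ I
      · simpa [hx, hy, Subtype.ext_iff.symm] using hxy
      · exact absurd (by simpa [hx, hy] using hxy.symm) (hfg ⟨y, hy⟩ x)
      · exact absurd (by simpa [hx, hy] using hxy) (hfg ⟨x, hx⟩ y)
      · simpa [hx, hy, hf.eq_iff] using hxy
  · exact EmbedsIn.exists_isTile h

/-! ### The upper bound and the theorem -/

/-- In a large colouring without a red `G`, all but fewer than `d + |H| - 1` vertices can be tiled by
blue copies of `H`. -/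
theorem exists_tiled_of_not_isContained {V W α : Type*} [Fintype V] [Fintype W] [Nonempty W]
    [Nonempty V] [Fintype α] [DecidableEq α] {G : SimpleGraph V} {H : SimpleGraph W} {k r d : ℕ}
    (hVk : Fintype.card V ≤ k) (hWk : Fintype.card W ≤ k)
    (hr : RamseyArrows (singleFamily G) (singleFamily H) r) (hr0 : 0 < r)
    (hd : RamseyArrows (deletionFamily G) (singleFamily H) d)
    (R : SimpleGraph α) (hR : ¬ G.IsContained R)
    (hcard : 2 ^ 20 * k ^ 8 * r ^ 2 ≤ Fintype.card α) :
    ∃ C : Finset α, Tiled H Rᶜ C ∧ Fintype.card α + 2 ≤ C.card + d + Fintype.card W := by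
  classical
  have hV0 : 0 < Fintype.card V := Fintype.card_pos
  have hW0 : 0 < Fintype.card W := Fintype.card_pos
  have hk : 0 < k := by omega
  obtain ⟨h, hh⟩ : ∃ h, h = Fintype.card W := ⟨_, rfl⟩
  rw [← hh] at hWk hW0 ⊢
  have htile : ∀ s : Finset α, r ≤ s.card → ∃ T ⊆ s, IsTile H Rᶜ T := fun s hs => by
    rcases hr.embedsIn R s hs with ⟨_, h⟩ | ⟨_, h⟩
    · exact absurd h.isContained hR
    · exact EmbedsIn.exists_isTile h
  have hind : ∀ I : Finset α, I.card = k → ¬ Rᶜ.IsIndepSet (I : Set α) := fun I hI hind => by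
    obtain ⟨J, hJ, hJc⟩ := Finset.exists_subset_card_eq (hVk.trans hI.ge)
    exact hR (isContained_of_isClique G R J hJc fun x hx y hy hne => by
      have := hind (hJ hx) (hJ hy) hne
      by_contra hxy
      exact this ((compl_adj _ _ _).mpr ⟨hne, hxy⟩))
  -- The parameters of the cluster and of the set `Y` of flexible vertices.
  obtain ⟨b, hb⟩ : ∃ b, b = r * h + r := ⟨_, rfl⟩
  -- More than b blue neighbours in Y leave r of them after rh have been used. Conversely, k
  -- vertices with at most b blue neighbours each leave k vertices of Y that are red to all of them.
  obtain ⟨m, hm⟩ : ∃ m, m = k * b + k := ⟨_, rfl⟩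
  -- Bounds 2 · 16k · h + h + 3, the cost of one branching.
  obtain ⟨c, hc⟩ : ∃ c, c = 36 * k ^ 2 := ⟨_, rfl⟩
  -- Leaves room for Y and r gadgets: m + rmc ≤ 111k⁴r².
  obtain ⟨t, ht⟩ : ∃ t, t = 2 ^ 7 * k ^ 4 * r ^ 2 := ⟨_, rfl⟩
  have hbr : b ≤ 2 * k * r := by nlinarith
  have hmr : m ≤ 3 * k ^ 2 * r := by nlinarith [Nat.mul_le_mul_left k hbr]
  have hmb : b + 1 ≤ m := by nlinarith
  have hmt : m + r * (m * c) ≤ t := by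
    have h1 : r * (m * c) ≤ 108 * k ^ 4 * r ^ 2 := by
      calc r * (m * c) ≤ r * (3 * k ^ 2 * r * c) := by gcongr
        _ = 108 * k ^ 4 * r ^ 2 := by rw [hc]; ring
    have h2 : k ^ 2 * r ≤ k ^ 4 * r ^ 2 :=
      Nat.mul_le_mul (Nat.pow_le_pow_right hk (by omega)) (Nat.le_self_pow two_ne_zero r)
    nlinarith
  have hkt : k ≤ k ^ 4 * r ^ 2 :=
    (Nat.le_self_pow (by omega) k).trans (Nat.le_mul_of_pos_right _ (by positivity))
  have hk8 : k ^ 5 * r ^ 2 ≤ k ^ 8 * r ^ 2 :=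
    Nat.mul_le_mul_right _ (Nat.pow_le_pow_right hk (by omega))
  have hrt : r ≤ t := by
    rw [ht]
    exact (Nat.le_self_pow two_ne_zero r).trans (Nat.le_mul_of_pos_left _ (by positivity))
  have ht' : t = 128 * (k ^ 4 * r ^ 2) := by rw [ht]; ring
  have hN : 2 ^ 20 * (k ^ 8 * r ^ 2) ≤ Fintype.card α := by rwa [← mul_assoc]
  obtain ⟨Q, hQ⟩ := exists_isCluster Rᶜ (M := t + r) (t := t) hk hind (by
      calc 2 ^ 11 * k ^ 4 * (t + r) ≤ 2 ^ 11 * k ^ 4 * (t + t) := by gcongr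
        _ = 2 ^ 19 * k ^ 8 * r ^ 2 := by rw [ht]; ring
        _ ≤ 2 ^ 20 * k ^ 8 * r ^ 2 := by gcongr <;> norm_num
        _ ≤ _ := hcard) (by omega) (by
      have h1 : 3 * t * (8 * k) = 3 * 2 ^ 10 * (k ^ 5 * r ^ 2) := by rw [ht]; ring
      have h2 : k ^ 4 * r ^ 2 ≤ k ^ 5 * r ^ 2 :=
        Nat.mul_le_mul_right _ (Nat.pow_le_pow_right hk (by omega))
      omega)
  obtain ⟨Y, hYQ, hYm⟩ := Finset.exists_subset_card_eq (s := Q) (n := m) (by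
    have := hQ.card_le
    omega)
  obtain ⟨U, hUY, -, hU⟩ := hQ.exists_flexible htile le_rfl (c := c) (by
      rw [← hh]
      have h1 : k * h ≤ k * k := Nat.mul_le_mul_left _ hWk
      have h2 : k * 1 ≤ k * k := Nat.mul_le_mul_left _ hk
      rw [hc]
      nlinarith) Y hYQ (by nlinarith) r (by rw [hYm]; exact hmt)
  -- The vertices outside are split according to their number of blue neighbours in `Y`.
  let E : Finset α := (Y ∪ U)ᶜ
  let P : Finset α := E.filter (fun v => (Y.filter (Rᶜ.Adj v)).card ≤ b)
  let A : Finset α := E.filter (fun v => ¬ (Y.filter (Rᶜ.Adj v)).card ≤ b)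
  have hEY : ∀ x ∈ E, x ∉ Y ∧ x ∉ U := fun x hx => by simpa [E] using hx
  have hPE : P ⊆ E := Finset.filter_subset _ _
  have hAE : A ⊆ E := Finset.filter_subset _ _
  have hPA : Disjoint P A := Finset.disjoint_filter_filter_not _ _ _
  obtain ⟨P₁, hP₁, hP₁t, hP₁c, -⟩ := exists_tiled_subset (H := H) (B := Rᶜ) (b := d) P
    fun s hs hsc => exists_isTile_of_few_neighbours R hR hd s Y
      (Finset.disjoint_left.mpr fun x hx => (hEY x (hPE (hs hx))).1)
      (by rw [hYm, hm]; exact Nat.add_le_add (Nat.mul_le_mul_right _ hVk) hVk)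
      (fun v hv => (Finset.mem_filter.mp (hs hv)).2) hsc
  obtain ⟨A₁, hA₁, hA₁t, hA₁c, -⟩ := exists_tiled_subset (H := H) (B := Rᶜ) (b := r) A
    fun s _ hsc => htile s hsc
  have hL : (A \ A₁).card * h ≤ r * h := Nat.mul_le_mul_right _ hA₁c.le
  obtain ⟨Y₁, hY₁, hY₁t, hY₁c⟩ := exists_tiled_cover htile Y (A \ A₁)
    (Finset.disjoint_left.mpr fun x hx => (hEY x (hAE (Finset.mem_sdiff.mp hx).1)).1)
    (fun v hv => by
      rw [← hh]
      have := (Finset.mem_filter.mp (Finset.mem_sdiff.mp hv).1).2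
      omega)
  rw [← hh] at hY₁c
  have hYY₁ := Finset.card_sdiff_add_card_eq_card hY₁
  -- The threshold r + h leaves at least r vertices for the absorber and at most h - 1 more.
  obtain ⟨Y₂, hY₂, hY₂t, hY₂c, hY₂h⟩ := exists_tiled_subset (H := H) (B := Rᶜ) (b := r + h) (Y \ Y₁)
    fun s _ hsc => htile s (by omega)
  obtain ⟨T, hT, hTc⟩ := Finset.exists_subset_card_eq (s := (Y \ Y₁) \ Y₂) (n := r) (by
    rw [← hh] at hY₂h
    rcases hY₂h with rfl | hY₂h
    · rw [Finset.sdiff_empty]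
      omega
    · omega)
  have hTY : T ⊆ Y := hT.trans (Finset.sdiff_subset.trans Finset.sdiff_subset)
  have hUT := hU T hTY hTc
  have hA₁E := hA₁.trans hAE
  have hP₁E := hP₁.trans hPE
  have hd₁ : Disjoint P₁ A₁ := Finset.disjoint_of_subset_left hP₁
    (Finset.disjoint_of_subset_right hA₁ hPA)
  have hd₂ : Disjoint (P₁ ∪ A₁) ((A \ A₁) ∪ Y₁) := by
    rw [Finset.disjoint_left]
    intro x hx hx'
    rw [Finset.mem_union] at hx hx'
    have hxE : x ∈ E := hx.elim (fun h => hP₁E h) (fun h => hA₁E h)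
    rcases hx' with hx' | hx'
    · rw [Finset.mem_sdiff] at hx'
      rcases hx with hx | hx
      · exact Finset.disjoint_left.mp hPA (hP₁ hx) hx'.1
      · exact hx'.2 hx
    · exact (hEY x hxE).1 (hY₁ hx')
  have hd₃ : Disjoint ((P₁ ∪ A₁) ∪ ((A \ A₁) ∪ Y₁)) Y₂ := by
    rw [Finset.disjoint_right]
    intro x hx hx'
    have hxY := Finset.mem_sdiff.mp (hY₂ hx)
    simp only [Finset.mem_union, Finset.mem_sdiff] at hx'
    rcases hx' with (hx' | hx') | hx' | hx'
    · exact (hEY x (hP₁E hx')).1 hxY.1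
    · exact (hEY x (hA₁E hx')).1 hxY.1
    · exact (hEY x (hAE hx'.1)).1 hxY.1
    · exact hxY.2 hx'
  have hd₄ : Disjoint (((P₁ ∪ A₁) ∪ ((A \ A₁) ∪ Y₁)) ∪ Y₂) (U ∪ T) := by
    rw [Finset.disjoint_left]
    intro x hx hx'
    have hcase : x ∈ E ∨ x ∈ Y₁ ∨ x ∈ Y₂ := by
      simp only [Finset.mem_union, Finset.mem_sdiff] at hx
      rcases hx with ((hx | hx) | hx | hx) | hx
      · exact Or.inl (hP₁E hx)
      · exact Or.inl (hA₁E hx)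
      · exact Or.inl (hAE hx.1)
      · exact Or.inr (Or.inl hx)
      · exact Or.inr (Or.inr hx)
    have hnotU : x ∈ Y → x ∉ U := fun h1 h2 => Finset.disjoint_left.mp hUY h2 h1
    rw [Finset.mem_union] at hx'
    rcases hx' with hx' | hx'
    · rcases hcase with h1 | h1 | h1
      · exact (hEY x h1).2 hx'
      · exact hnotU (hY₁ h1) hx'
      · exact hnotU (Finset.mem_sdiff.mp (hY₂ h1)).1 hx'
    · have hxT := hT hx'
      simp only [Finset.mem_sdiff] at hxT
      rcases hcase with h1 | h1 | h1
      · exact (hEY x h1).1 hxT.1.1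
      · exact hxT.1.2 h1
      · exact hxT.2 h1
  refine ⟨_, (((hP₁t.disjoint_union hA₁t hd₁).disjoint_union hY₁t hd₂).disjoint_union hY₂t
    hd₃).disjoint_union hUT hd₄, ?_⟩
  set C := (((P₁ ∪ A₁) ∪ ((A \ A₁) ∪ Y₁)) ∪ Y₂) ∪ (U ∪ T) with hC
  -- At most d - 1 vertices of `P` and h - 1 of `Y` remain uncovered.
  have hsub : Cᶜ ⊆ (P \ P₁) ∪ (((Y \ Y₁) \ Y₂) \ T) := by
    intro x hx
    simp only [hC, Finset.mem_compl, Finset.mem_union, Finset.mem_sdiff, not_or] at hx ⊢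
    by_cases hxE : x ∈ E
    · by_cases hxP : x ∈ P
      · exact Or.inl ⟨hxP, hx.1.1.1.1⟩
      · have hxA : x ∈ A := Finset.mem_filter.mpr ⟨hxE, fun h1 => hxP (Finset.mem_filter.mpr
          ⟨hxE, h1⟩)⟩
        exact absurd ⟨hxA, hx.1.1.1.2⟩ hx.1.1.2.1
    · rw [Finset.mem_compl, not_not, Finset.mem_union] at hxE
      exact Or.inr ⟨⟨⟨hxE.resolve_right hx.2.1, hx.1.1.2.2⟩, hx.1.2⟩, hx.2.2⟩
  have h1 := Finset.card_le_card hsub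
  have h2 := Finset.card_union_le (P \ P₁) (((Y \ Y₁) \ Y₂) \ T)
  have h3 := Finset.card_sdiff_add_card_eq_card hT
  have h4 := Finset.card_add_card_compl C
  omega

theorem ramseyArrows_disjointCopies {V W : Type*} [Fintype V] [Fintype W] [Nonempty W] [Nonempty V]
    {G : SimpleGraph V} {H : SimpleGraph W} {k r d n : ℕ}
    (hVk : Fintype.card V ≤ k) (hWk : Fintype.card W ≤ k)
    (hr : RamseyArrows (singleFamily G) (singleFamily H) r) (hr0 : 0 < r)
    (hd : RamseyArrows (deletionFamily G) (singleFamily H) d) (hd0 : 0 < d)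
    (hn : 2 ^ 20 * k ^ 8 * r ^ 2 ≤ n) :
    RamseyArrows (singleFamily G) (singleFamily (disjointCopies n H))
      (n * Fintype.card W + d - 1) := by
  intro R
  have hW0 : 0 < Fintype.card W := Fintype.card_pos
  have hnW : n * 1 ≤ n * Fintype.card W := Nat.mul_le_mul_left _ hW0
  by_cases hR : G.IsContained R
  · exact Or.inl ⟨(), hR⟩
  · obtain ⟨C, hC, hCc⟩ := exists_tiled_of_not_isContained hVk hWk hr hr0 hd R hR (by
      rw [Fintype.card_fin]
      omega)
    obtain ⟨n', hn', hemb⟩ := hC.exists_embedsIn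
    -- The order of `C` is a multiple of |H| and exceeds (n - 1)|H|.
    have hle : n ≤ n' := by
      rw [Fintype.card_fin, hn'] at hCc
      by_contra! hlt
      have : (n' + 1) * Fintype.card W ≤ n * Fintype.card W := Nat.mul_le_mul_right _ hlt
      rw [add_mul, one_mul] at this
      omega
    exact Or.inr ⟨(), (disjointCopies_isContained hle).trans hemb.isContained⟩

theorem theorem1p3 {V W : Type*} [Fintype V] [Fintype W]
    (G : SimpleGraph V) (H : SimpleGraph W) (hG : G ≠ ⊥) (hH : H.Connected)
    (k : ℕ) (hk : k = max (Fintype.card V) (Fintype.card W))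
    (n : ℕ) (hn : 2 ^ 32 * k ^ 10 * graphRamsey G H ^ 2 ≤ n) :
    graphRamsey G (disjointCopies n H) =
      n * Fintype.card W + familyRamsey (deletionFamily G) (singleFamily H) - 1 := by
  have hW : Nonempty W := hH.nonempty
  obtain ⟨I, -, hI⟩ := exists_maximal_isIndepSet_superset G ∅ (by simp)
  have hne : ∀ J : {I : Set V // Maximal G.IsIndepSet I}, Nonempty ((J : Set V)ᶜ : Set V) :=
    fun J => nonempty_compl_of_isIndepSet hG J.2.1
  have hV : Nonempty V := (hne ⟨I, hI⟩).map Subtype.val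
  have hW0 : 0 < Fintype.card W := Fintype.card_pos
  have hr := ramseyArrows_familyRamsey (singleFamily G) (singleFamily H) () ()
  have hr0 := familyRamsey_pos (singleFamily G) (singleFamily H) () ()
  have hd := ramseyArrows_familyRamsey (deletionFamily G) (singleFamily H) ⟨I, hI⟩ ()
  have hd0 := familyRamsey_pos (deletionFamily G) (singleFamily H) ⟨I, hI⟩ ()
  have hVk : Fintype.card V ≤ k := hk ▸ le_max_left _ _
  have hWk : Fintype.card W ≤ k := hk ▸ le_max_right _ _
  have hk0 : 0 < k := by omega
  have hn0 : 0 < n := lt_of_lt_of_le (by have : 0 < graphRamsey G H := hr0; positivity) hn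
  have hnW : 0 < n * Fintype.card W := by positivity
  -- The absorption argument already works for n ≥ 2²⁰k⁸r².
  have hup := ramseyArrows_disjointCopies hVk hWk hr hr0 hd hd0 (n := n) (le_trans (by
    have : k ^ 8 ≤ k ^ 10 := Nat.pow_le_pow_right hk0 (by omega)
    change _ ≤ 2 ^ 32 * k ^ 10 * familyRamsey (singleFamily G) (singleFamily H) ^ 2
    gcongr
    all_goals norm_num) hn)
  refine le_antisymm (Nat.sInf_le hup) ?_
  by_contra! hlt
  refine not_ramseyArrows_disjointCopies (n := n) (a := n * Fintype.card W - 1) hH (by omega)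
    (not_ramseyArrows_of_lt (Nat.sub_one_lt hd0.ne'))
    ((ramseyArrows_familyRamsey (singleFamily G) (singleFamily (disjointCopies n H)) () ()).mono ?_)
  change graphRamsey G (disjointCopies n H) ≤ _
  omega
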